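/- Let $\Lambda$ be a finite-dimensional algebra over a field, with Jacobson radical $J$. Let $e,f\in\Lambda$ be primitive idempotents, let $0\neq a\in fJe$, and suppose that the left $\Lambda$-module $U=\Lambda e/\Lambda a$ is uniserial, i.e. has exactly one composition series. Let $$0\longrightarrow A\longrightarrow B\longrightarrow U\longrightarrow 0$$ be an almost split sequence ending in $U$ in the category of finitely generated left $\Lambda$-modules. Then $\alpha(U)\le 2$, where $\alpha(U)$ is the number of summands in a decomposition of $B$ into a direct sum of indecomposable modules; that is, $B$ is a direct sum of at most two indecomposable modules, and every decomposition of $B$ as a finite direct sum of indecomposable modules has at most two summands. -/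

import Mathlib

universe u v w

/-- An idempotent is primitive if it is nonzero and is not a sum of two nonzero
orthogonal idempotents. -/
def IsPrimitiveIdempotent {R : Type u} [Ring R] (e : R) : Prop :=
  IsIdempotentElem e ∧ e ≠ 0 ∧
    ∀ x y : R, IsIdempotentElem x → IsIdempotentElem y → x * y = 0 → y * x = 0 →
      x + y = e → x = 0 ∨ y = 0

/-- The set `f J e`, where `J` is the Jacobson radical of the ring. -/
def radicalCorner {R : Type u} [Ring R] (f e : R) : Set R :=
  {a | ∃ j ∈ Ring.jacobson R, a = f * j * e}

/-- The left module `Re / Ra`. It is formed as the quotient of the left ideal `Re` by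
`Ra ∩ Re`, which is `Ra` whenever `a ∈ Re`. -/
abbrev CyclicQuotient {R : Type u} [Ring R] (e a : R) : Type u :=
  ↥(Submodule.span R {e}) ⧸ (Submodule.span R {a}).submoduleOf (Submodule.span R {e})

/-- A module is uniserial if it has exactly one composition series (a finite chain of
submodules from `0` to the whole module with simple factors). -/
def IsUniserial (R : Type u) [Ring R] (M : Type v) [AddCommGroup M] [Module R M] : Prop :=
  ∃! s : CompositionSeries (Submodule R M), s.head = ⊥ ∧ s.last = ⊤

/-- A module is indecomposable if it is nonzero and is not the internal direct sum of two
nonzero submodules. -/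
def IsIndecomposableModule (R : Type u) [Ring R] (M : Type v) [AddCommGroup M]
    [Module R M] : Prop :=
  Nontrivial M ∧ ∀ N N' : Submodule R M, IsCompl N N' → N = ⊥ ∨ N' = ⊥

/-- `M` is a direct sum of exactly `n` indecomposable submodules. -/
def HasIndecomposableDecomposition (R : Type u) [Ring R] (M : Type v) [AddCommGroup M]
    [Module R M] (n : ℕ) : Prop :=
  ∃ N : Fin n → Submodule R M,
    DirectSum.IsInternal N ∧ ∀ i, IsIndecomposableModule R (N i)

/-- A homomorphism with a right inverse. -/
def IsSplitEpimorphism {R : Type u} [Ring R] {M : Type v} {N : Type w} [AddCommGroup M]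
    [Module R M] [AddCommGroup N] [Module R N] (g : M →ₗ[R] N) : Prop :=
  ∃ s : N →ₗ[R] M, g ∘ₗ s = LinearMap.id

/-- A homomorphism with a left inverse. -/
def IsSplitMonomorphism {R : Type u} [Ring R] {M : Type v} {N : Type w} [AddCommGroup M]
    [Module R M] [AddCommGroup N] [Module R N] (f : M →ₗ[R] N) : Prop :=
  ∃ r : N →ₗ[R] M, r ∘ₗ f = LinearMap.id

/-- `g : B → C` is right almost split in the category of finitely generated modules: it is
not a split epimorphism, and every homomorphism `X → C` from a finitely generated module that
is not a split epimorphism factors through `g`. (Every finitely generated module over `R` is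
isomorphic to one in the universe of `R`.) -/
def IsRightAlmostSplit {R : Type u} [Ring R] {B C : Type u} [AddCommGroup B] [Module R B]
    [AddCommGroup C] [Module R C] (g : B →ₗ[R] C) : Prop :=
  ¬ IsSplitEpimorphism g ∧
    ∀ (X : Type u) [AddCommGroup X] [Module R X] [Module.Finite R X] (h : X →ₗ[R] C),
      ¬ IsSplitEpimorphism h → ∃ h' : X →ₗ[R] B, g ∘ₗ h' = h

/-- `f : A → B` is left almost split in the category of finitely generated modules: it is
not a split monomorphism, and every homomorphism `A → Y` to a finitely generated module that
is not a split monomorphism factors through `f`. -/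
def IsLeftAlmostSplit {R : Type u} [Ring R] {A B : Type u} [AddCommGroup A] [Module R A]
    [AddCommGroup B] [Module R B] (f : A →ₗ[R] B) : Prop :=
  ¬ IsSplitMonomorphism f ∧
    ∀ (Y : Type u) [AddCommGroup Y] [Module R Y] [Module.Finite R Y] (h : A →ₗ[R] Y),
      ¬ IsSplitMonomorphism h → ∃ h' : B →ₗ[R] Y, h' ∘ₗ f = h

/-- `0 → A → B → C → 0` is an almost split sequence (Auslander–Reiten sequence) of finitely
generated modules. -/
structure IsAlmostSplitSequence {R : Type u} [Ring R] {A B C : Type u}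
    [AddCommGroup A] [Module R A] [AddCommGroup B] [Module R B]
    [AddCommGroup C] [Module R C] (f : A →ₗ[R] B) (g : B →ₗ[R] C) : Prop where
  finite_left : Module.Finite R A
  finite_middle : Module.Finite R B
  finite_right : Module.Finite R C
  injective : Function.Injective f
  exact : Function.Exact f g
  surjective : Function.Surjective g
  leftAlmostSplit : IsLeftAlmostSplit f
  rightAlmostSplit : IsRightAlmostSplit g

/-!
A submodule `k ≤ B` with `k` and `B / k` uniform leaves no room for three independent nonzero
submodules of `B`, so it suffices that both ends of the sequence are uniform. The right end `U` is
uniserial. For the left end `A`, lift the generator of `U = Λe / Λa` to `b ∈ B`: since the sequence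
does not split, `a • b = i x` with `x ∈ fA` outside `aA`, and since it is left almost split,
`x ∈ aA + S` for every nonzero `S ≤ A`. A `K`-linear functional on `fA` vanishing on `aA` but not at
`x` is therefore nonzero on `S` for every such `S`, which exhibits `Hom_K(A, K)` as a cyclic right
module, a quotient of `fΛ`. Such a quotient has at most one maximal submodule, as `fΛf` is local, so
`A` has at most one simple submodule.
-/

section Lattice

variable {L : Type*}

/-- Any two nonzero elements have nonzero meet. A module is uniform when its lattice of
submodules has this property; the zero module is allowed here. -/
def IsUniformOrder (L : Type*) [SemilatticeInf L] [OrderBot L] : Prop :=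
  ∀ ⦃x y : L⦄, Disjoint x y → x = ⊥ ∨ y = ⊥

/-- No three nonzero elements are independent. For the lattice of submodules of a module this
says that the uniform (Goldie) dimension is at most two. -/
def UniformDimLETwo (L : Type*) [Lattice L] [OrderBot L] : Prop :=
  ∀ ⦃x y z : L⦄, Disjoint x y → Disjoint (x ⊔ y) z → x = ⊥ ∨ y = ⊥ ∨ z = ⊥

theorem IsUniformOrder.of_total [SemilatticeInf L] [OrderBot L]
    (h : ∀ x y : L, x ≤ y ∨ y ≤ x) : IsUniformOrder L := fun x y hxy ↦
  (h x y).imp hxy.eq_bot_of_le hxy.symm.eq_bot_of_le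

theorem IsUniformOrder.of_orderIso {L' : Type*} [SemilatticeInf L] [OrderBot L]
    [SemilatticeInf L'] [OrderBot L'] (φ : L ≃o L') (h : IsUniformOrder L) :
    IsUniformOrder L' := fun x y hxy ↦ by
  simpa using h (hxy.map_orderIso φ.symm)

variable [Lattice L] [OrderBot L]

theorem IsUniformOrder.disjoint_Iic {k x y : L} (hk : IsUniformOrder (Set.Iic k))
    (hxk : x ≤ k) (hyk : y ≤ k) (hxy : Disjoint x y) : x = ⊥ ∨ y = ⊥ := by
  have h : Disjoint (⟨x, hxk⟩ : Set.Iic k) ⟨y, hyk⟩ :=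
    disjoint_iff.2 (Subtype.ext hxy.eq_bot)
  exact (hk h).imp (congrArg Subtype.val) (congrArg Subtype.val)

theorem IsUniformOrder.not_disjoint_sup [IsModularLattice L] {k x y : L}
    (hk : IsUniformOrder (Set.Ici k)) (hxy : Disjoint x y) (hx : x ≠ ⊥) (hy : y ≠ ⊥) :
    ¬ Disjoint (x ⊔ y) k := by
  intro hxyk
  have hinf : (x ⊔ k) ⊓ (y ⊔ k) = k := by
    rw [inf_comm, IsModularLattice.sup_inf_sup_assoc,
      (hxy.disjoint_sup_right_of_disjoint_sup_left hxyk).symm.eq_bot, bot_sup_eq]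
  have h : Disjoint (⟨x ⊔ k, le_sup_right⟩ : Set.Ici k) ⟨y ⊔ k, le_sup_right⟩ :=
    disjoint_iff.2 (Subtype.ext hinf)
  have eq_bot_of_sup_eq {z : L} (hz : z ≤ x ⊔ y)
      (h : (⟨z ⊔ k, le_sup_right⟩ : Set.Ici k) = ⊥) : z = ⊥ :=
    (hxyk.mono_left hz).eq_bot_of_le (sup_eq_right.1 (congrArg Subtype.val h))
  exact (hk h).elim (hx ∘ eq_bot_of_sup_eq le_sup_left) (hy ∘ eq_bot_of_sup_eq le_sup_right)

theorem IsUniformOrder.not_disjoint_of_disjoint_sup [IsModularLattice L] {k x y z : L}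
    (hk : IsUniformOrder (Set.Iic k)) (h : Disjoint x (y ⊔ z)) (hxz : ¬ Disjoint (x ⊔ z) k)
    (hyz : ¬ Disjoint (y ⊔ z) k) : ¬ Disjoint z k := by
  intro hzk
  have hinf : (x ⊔ z) ⊓ (y ⊔ z) = z := by
    rw [inf_comm, IsModularLattice.sup_inf_sup_assoc, h.symm.eq_bot, bot_sup_eq]
  have hdisj : Disjoint ((x ⊔ z) ⊓ k) ((y ⊔ z) ⊓ k) := by
    rw [disjoint_iff, ← inf_inf_distrib_right, hinf, hzk.eq_bot]
  exact (hk.disjoint_Iic inf_le_right inf_le_right hdisj).elim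
    (hxz ∘ disjoint_iff.2) (hyz ∘ disjoint_iff.2)

theorem UniformDimLETwo.of_Iic_of_Ici [IsModularLattice L] {k : L}
    (hIic : IsUniformOrder (Set.Iic k)) (hIci : IsUniformOrder (Set.Ici k)) :
    UniformDimLETwo L := by
  intro x y z hxy hxyz
  by_contra! ⟨hx, hy, hz⟩
  have hxz : Disjoint x z := hxyz.mono_left le_sup_left
  have hyz : Disjoint y z := hxyz.mono_left le_sup_right
  have hx_yz : Disjoint x (y ⊔ z) := hxy.disjoint_sup_right_of_disjoint_sup_left hxyz
  have hxy_k : ¬ Disjoint (x ⊔ y) k := hIci.not_disjoint_sup hxy hx hy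
  have hxz_k : ¬ Disjoint (x ⊔ z) k := hIci.not_disjoint_sup hxz hx hz
  have hyz_k : ¬ Disjoint (y ⊔ z) k := hIci.not_disjoint_sup hyz hy hz
  have hz_k : ¬ Disjoint z k := hIic.not_disjoint_of_disjoint_sup hx_yz hxz_k hyz_k
  have hy_k : ¬ Disjoint y k := by
    rw [sup_comm y z] at hx_yz hyz_k
    exact hIic.not_disjoint_of_disjoint_sup hx_yz hxy_k hyz_k
  exact (hIic.disjoint_Iic inf_le_right inf_le_right (hyz.mono inf_le_left inf_le_left)).elim
    (hy_k ∘ disjoint_iff.2) (hz_k ∘ disjoint_iff.2)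

end Lattice

section Module

variable {R : Type u} [Ring R]

theorem IsUniserial.le_total {M : Type v} [AddCommGroup M] [Module R M] (h : IsUniserial R M)
    (N N' : Submodule R M) : N ≤ N' ∨ N' ≤ N := by
  obtain ⟨s, hs, hs_unique⟩ := h
  have ⟨_, _⟩ := isFiniteLength_iff_isNoetherian_isArtinian.1
    (isFiniteLength_iff_exists_compositionSeries.2 ⟨s, hs⟩)
  have mem_series (X : Submodule R M) : X ∈ s := by
    obtain ⟨t, j, hj, ht⟩ := LTSeries.exists_relSeries_covBy_and_head_eq_bot_and_last_eq_bot
      (RelSeries.singleton {(a, b) : Submodule R M × Submodule R M | a < b} X)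
    rw [← hs_unique t ht]
    exact ⟨j 0, congr_fun hj 0⟩
  exact CompositionSeries.total (mem_series N) (mem_series N')

theorem UniformDimLETwo.of_exact {A B C : Type*} [AddCommGroup A] [Module R A]
    [AddCommGroup B] [Module R B] [AddCommGroup C] [Module R C] {i : A →ₗ[R] B}
    {p : B →ₗ[R] C} (hi : Function.Injective i) (hip : Function.Exact i p)
    (hp : Function.Surjective p) (hA : IsUniformOrder (Submodule R A))
    (hC : IsUniformOrder (Submodule R C)) : UniformDimLETwo (Submodule R B) := by
  refine .of_Iic_of_Ici (k := LinearMap.ker p) ?_ ?_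
  · rw [hip.linearMap_ker_eq]
    exact hA.of_orderIso
      ((Submodule.orderIsoMapComap (LinearEquiv.ofInjective i hi)).trans (Submodule.mapIic _))
  · exact hC.of_orderIso ((Submodule.orderIsoMapComap
      (p.quotKerEquivOfSurjective hp).symm).trans (Submodule.comapMkQRelIso _))

section Decomposition

variable {M : Type v} [AddCommGroup M] [Module R M]

theorem isIndecomposableModule_of_disjoint_sup_eq {N : Submodule R M} (hN : N ≠ ⊥)
    (h : ∀ X Y : Submodule R M, Disjoint X Y → X ⊔ Y = N → X = ⊥ ∨ Y = ⊥) :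
    IsIndecomposableModule R N := by
  refine ⟨Submodule.nontrivial_iff_ne_bot.2 hN, fun X Y hXY ↦ ?_⟩
  have hinj : Function.Injective N.subtype := N.injective_subtype
  have hsup : X.map N.subtype ⊔ Y.map N.subtype = N := by
    rw [← Submodule.map_sup, hXY.sup_eq_top, Submodule.map_subtype_top]
  have map_eq_bot {Z : Submodule R N} : Z.map N.subtype = ⊥ → Z = ⊥ := fun hZ ↦
    Submodule.map_injective_of_injective hinj (hZ.trans (Submodule.map_bot _).symm)
  exact (h _ _ (Submodule.disjoint_map hinj hXY.disjoint) hsup).imp map_eq_bot map_eq_bot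

theorem UniformDimLETwo.isIndecomposableModule (h : UniformDimLETwo (Submodule R M))
    {N N' : Submodule R M} (hNN' : Disjoint N N') (hN : N ≠ ⊥) (hN' : N' ≠ ⊥) :
    IsIndecomposableModule R N :=
  isIndecomposableModule_of_disjoint_sup_eq hN fun _ _ hXY hsup ↦
    (h hXY (hsup ▸ hNN')).imp_right (Or.resolve_right · hN')

theorem hasIndecomposableDecomposition_zero [Subsingleton M] :
    HasIndecomposableDecomposition R M 0 := by
  refine ⟨Fin.elim0, ?_, Fin.rec0⟩
  rw [DirectSum.isInternal_submodule_iff_iSupIndep_and_iSup_eq_top]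
  exact ⟨Fin.rec0, Subsingleton.elim _ _⟩

theorem hasIndecomposableDecomposition_one
    (h : IsIndecomposableModule R (⊤ : Submodule R M)) :
    HasIndecomposableDecomposition R M 1 := by
  refine ⟨fun _ ↦ ⊤, ?_, fun _ ↦ h⟩
  rw [DirectSum.isInternal_submodule_iff_iSupIndep_and_iSup_eq_top]
  exact ⟨iSupIndep_subsingleton _, ciSup_const⟩

theorem hasIndecomposableDecomposition_two {N N' : Submodule R M} (hNN' : IsCompl N N')
    (hN : IsIndecomposableModule R N) (hN' : IsIndecomposableModule R N') :
    HasIndecomposableDecomposition R M 2 := by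
  refine ⟨![N, N'], ?_, Fin.forall_fin_two.2 ⟨hN, hN'⟩⟩
  rw [DirectSum.isInternal_submodule_iff_isCompl (i := 0) (j := 1) _ (by decide)
    (by ext j; fin_cases j <;> simp)]
  exact hNN'

theorem UniformDimLETwo.exists_hasIndecomposableDecomposition
    (h : UniformDimLETwo (Submodule R M)) :
    ∃ n ≤ 2, HasIndecomposableDecomposition R M n := by
  rcases subsingleton_or_nontrivial M with _ | _
  · exact ⟨0, zero_le_two, hasIndecomposableDecomposition_zero⟩
  by_cases hind : IsIndecomposableModule R (⊤ : Submodule R M)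
  · exact ⟨1, one_le_two, hasIndecomposableDecomposition_one hind⟩
  obtain ⟨N, N', hNN', hsup, hN, hN'⟩ : ∃ N N' : Submodule R M,
      Disjoint N N' ∧ N ⊔ N' = ⊤ ∧ N ≠ ⊥ ∧ N' ≠ ⊥ := by
    by_contra! hnone
    exact hind (isIndecomposableModule_of_disjoint_sup_eq top_ne_bot fun N N' hNN' hsup ↦
      or_iff_not_imp_left.2 (hnone N N' hNN' hsup))
  exact ⟨2, le_rfl, hasIndecomposableDecomposition_two ⟨hNN', codisjoint_iff.2 hsup⟩
    (h.isIndecomposableModule hNN' hN hN') (h.isIndecomposableModule hNN'.symm hN' hN)⟩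

theorem UniformDimLETwo.le_two_of_hasIndecomposableDecomposition
    (h : UniformDimLETwo (Submodule R M)) {n : ℕ} (hn : HasIndecomposableDecomposition R M n) :
    n ≤ 2 := by
  obtain ⟨N, hN, hind⟩ := hn
  by_contra! h2
  have hindep : iSupIndep N := hN.submodule_iSupIndep
  have ne_bot (j : Fin n) : N j ≠ ⊥ := Submodule.nontrivial_iff_ne_bot.1 (hind j).1
  let j₀ : Fin n := ⟨0, by omega⟩
  let j₁ : Fin n := ⟨1, by omega⟩
  let j₂ : Fin n := ⟨2, by omega⟩
  have h₀₁ : Disjoint (N j₀) (N j₁) := hindep.pairwiseDisjoint (by simp [j₀, j₁])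
  have h₂ : Disjoint (N j₀ ⊔ N j₁) (N j₂) := (hindep j₂).symm.mono_left
    (sup_le (le_iSup₂_of_le j₀ (by simp [j₀, j₂]) le_rfl)
      (le_iSup₂_of_le j₁ (by simp [j₁, j₂]) le_rfl))
  rcases h h₀₁ h₂ with h | h | h <;> exact ne_bot _ h

end Decomposition

end Module

section PrimitiveIdempotent

open Polynomial in
theorem exists_commute_pow_succ_mul_eq_pow_of_isIntegral {K : Type*} {R : Type*} [Field K] [Ring R]
    [Algebra K R] {r : R} (hr : IsIntegral K r) :
    ∃ n, ∃ s, Commute r s ∧ r ^ (n + 1) * s = r ^ n := by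
  obtain ⟨q, hq, hdvd⟩ := (minpoly K r).exists_eq_pow_rootMultiplicity_mul_and_not_dvd
    (minpoly.ne_zero hr) 0
  rw [map_zero, sub_zero] at hq hdvd
  set n := (minpoly K r).rootMultiplicity 0
  have hq0 : q.coeff 0 ≠ 0 := fun h ↦ hdvd (X_dvd_iff.2 h)
  set c : K := (q.coeff 0)⁻¹
  have hpoly : C c * minpoly K r = X ^ n - X ^ (n + 1) * -(C c * q.divX) := by
    have hc : C c * C (q.coeff 0) = 1 := by rw [← C_mul, inv_mul_cancel₀ hq0, C_1]
    rw [hq]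
    nth_rewrite 1 [← q.divX_mul_X_add]
    linear_combination X ^ n * hc
  refine ⟨n, aeval r (-(C c * q.divX)), ?_, ?_⟩
  · simpa using (Commute.all X (-(C c * q.divX))).map (aeval r)
  · have h := congrArg (aeval r) hpoly
    rw [map_mul, minpoly.aeval, mul_zero, map_sub, map_mul, map_pow, map_pow, aeval_X] at h
    exact (sub_eq_zero.1 h.symm).symm

theorem IsPrimitiveIdempotent.eq_zero_or_eq {R : Type u} [Ring R] {f h : R}
    (hf : IsPrimitiveIdempotent f) (hh : IsIdempotentElem h) (hfh : f * h = h)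
    (hhf : h * f = h) : h = 0 ∨ h = f := by
  have h_mul_sub : h * (f - h) = 0 := by rw [mul_sub, hhf, hh.eq, sub_self]
  have sub_mul_h : (f - h) * h = 0 := by rw [sub_mul, hfh, hh.eq, sub_self]
  have hfh_idem : IsIdempotentElem (f - h) := by
    rw [IsIdempotentElem, mul_sub, sub_mul_h, sub_zero, sub_mul, hf.1.eq, hhf]
  exact (hf.2.2 h (f - h) hh hfh_idem h_mul_sub sub_mul_h (add_sub_cancel h f)).imp_right
    fun h0 ↦ (sub_eq_zero.1 h0).symm

theorem IsPrimitiveIdempotent.isNilpotent_or_exists_mul_eq {R : Type u} [Ring R] {f r s : R}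
    {n : ℕ} (hf : IsPrimitiveIdempotent f) (hfr : f * r = r) (hrf : r * f = r)
    (hrs : Commute r s) (hpow : r ^ (n + 1) * s = r ^ n) :
    IsNilpotent r ∨ ∃ t, r * t = f := by
  have pow_add_mul_pow (k : ℕ) : r ^ (n + k) * s ^ k = r ^ n := by
    induction k with
    | zero => simp
    | succ k ih =>
      rw [← add_assoc, add_right_comm, pow_add _ (n + 1), pow_succ' s, ← mul_assoc,
        mul_assoc (r ^ (n + 1)), (hrs.pow_left k).eq, ← mul_assoc, hpow, ← pow_add, ih]
  -- `h` is the idempotent projecting onto the part of `R` where `r` acts invertibly.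
  set h := r ^ (n + 1) * s ^ (n + 1)
  have h_eq : h = s ^ (n + 1) * r ^ (n + 1) := hrs.pow_pow _ _
  have pow_mul_h : r ^ (n + 1) * h = r ^ (n + 1) := by
    rw [← mul_assoc, ← pow_add, add_right_comm, pow_succ', mul_assoc, pow_add_mul_pow, pow_succ']
  have h_idem : IsIdempotentElem h := by
    rw [IsIdempotentElem]
    nth_rewrite 1 [h_eq]
    rw [mul_assoc, pow_mul_h, ← h_eq]
  have f_mul_pow : f * r ^ (n + 1) = r ^ (n + 1) := by rw [pow_succ', ← mul_assoc, hfr]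
  have pow_mul_f : r ^ (n + 1) * f = r ^ (n + 1) := by rw [pow_succ, mul_assoc, hrf]
  have hfh : f * h = h := by rw [← mul_assoc, f_mul_pow]
  have hhf : h * f = h := by rw [h_eq, mul_assoc, pow_mul_f]
  rcases hf.eq_zero_or_eq h_idem hfh hhf with h0 | hf_eq
  · exact .inl ⟨n + 1, by rw [← pow_mul_h, h0, mul_zero]⟩
  · exact .inr ⟨r ^ n * s ^ (n + 1), by rw [← mul_assoc, ← pow_succ', ← hf_eq]⟩

end PrimitiveIdempotent

section Duality

variable {K : Type v} [Field K] {Λ : Type u} [Ring Λ] [Algebra K Λ] [Module.Finite K Λ]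
  {A : Type w} [AddCommGroup A] [Module Λ A] [Module K A] [IsScalarTower K Λ A]

theorem exists_forall_dual_apply_eq_apply_smul {ψ : Module.Dual K A}
    (hψ : ∀ S : Submodule Λ A, S ≠ ⊥ → ∃ s ∈ S, ψ s ≠ 0) (χ : Module.Dual K A) :
    ∃ r : Λ, ∀ y, χ y = ψ (r • y) := by
  let F : Λ →ₗ[K] Module.Dual K A := (Algebra.lsmul K K A).toLinearMap.compr₂ ψ
  have coannihilator_eq_bot : (LinearMap.range F).dualCoannihilator = ⊥ := by
    refine (Submodule.eq_bot_iff _).2 fun y hy ↦ ?_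
    by_contra hy0
    obtain ⟨s, hs, hs0⟩ := hψ (Submodule.span Λ {y}) (mt Submodule.span_singleton_eq_bot.1 hy0)
    obtain ⟨r, rfl⟩ := Submodule.mem_span_singleton.1 hs
    exact hs0 ((Submodule.mem_dualCoannihilator _).1 hy _ ⟨r, rfl⟩)
  have range_eq_top : LinearMap.range F = ⊤ := by
    rw [← Subspace.dualCoannihilator_dualAnnihilator_eq (W := LinearMap.range F),
      coannihilator_eq_bot, Submodule.dualAnnihilator_bot]
  obtain ⟨r, rfl⟩ := LinearMap.range_eq_top.1 range_eq_top χ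
  exact ⟨r, fun _ ↦ rfl⟩

-- `ψ` makes `Hom_K(A, K)` a quotient of the right module `fΛ`, which has a unique maximal
-- submodule because `fΛf` is local; dually, `A` has a simple socle.
theorem IsPrimitiveIdempotent.isUniformOrder_submodule {f : Λ} (hf : IsPrimitiveIdempotent f)
    {ψ : Module.Dual K A} (hψf : ∀ y, ψ (f • y) = ψ y)
    (hψ : ∀ S : Submodule Λ A, S ≠ ⊥ → ∃ s ∈ S, ψ s ≠ 0) :
    IsUniformOrder (Submodule Λ A) := by
  intro S T hST
  by_contra! ⟨hS, hT⟩
  have hdual :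
      (S.restrictScalars K).dualAnnihilator ⊔ (T.restrictScalars K).dualAnnihilator = ⊤ := by
    rw [← Subspace.dualAnnihilator_inf_eq, ← Submodule.restrictScalars_inf]
    simp [hST.eq_bot]
  obtain ⟨χ, hχS, χ', hχT, hχψ⟩ := Submodule.mem_sup.1 (hdual ▸ Submodule.mem_top (x := ψ))
  obtain ⟨x, hx⟩ := exists_forall_dual_apply_eq_apply_smul hψ χ
  set r := f * x * f
  have hfr : f * r = r := by simp only [r, ← mul_assoc, hf.1.eq]
  have hrf : r * f = r := by simp only [r, mul_assoc, hf.1.eq]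
  have ψ_smul_eq (y : A) : ψ (r • y) = χ (f • y) := by
    simp only [r, mul_smul, hψf, hx]
  have ψ_eq_zero_of_mem_S {y : A} (hy : y ∈ S) : ψ (r • y) = 0 := by
    rw [ψ_smul_eq]
    exact (Submodule.mem_dualAnnihilator χ).1 hχS _ (S.smul_mem f hy)
  have ψ_eq_zero_of_mem_T {y : A} (hy : y ∈ T) : ψ ((1 - r) • y) = 0 := by
    rw [sub_smul, one_smul, map_sub, ψ_smul_eq, ← hψf y, ← hχψ, LinearMap.add_apply,
      add_sub_cancel_left]
    exact (Submodule.mem_dualAnnihilator χ').1 hχT _ (T.smul_mem f hy)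
  obtain ⟨n, s, hrs, hpow⟩ :=
    exists_commute_pow_succ_mul_eq_pow_of_isIntegral (Algebra.IsIntegral.isIntegral (R := K) r)
  rcases hf.isNilpotent_or_exists_mul_eq hfr hrf hrs hpow with hr | ⟨t, ht⟩
  · obtain ⟨t, ht⟩ := hr.isUnit_one_sub.exists_right_inv
    obtain ⟨y, hy, hy0⟩ := hψ T hT
    exact hy0 (by rw [← one_smul Λ y, ← ht, mul_smul, ψ_eq_zero_of_mem_T (T.smul_mem t hy)])
  · obtain ⟨y, hy, hy0⟩ := hψ S hS
    exact hy0 (by rw [← hψf, ← ht, mul_smul, ψ_eq_zero_of_mem_S (S.smul_mem t hy)])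

end Duality

namespace CyclicQuotient

variable {R : Type u} [Ring R] {e a : R}

/-- The class of `e` in `Re / Ra`. It generates the module when `e` is idempotent. -/
def generator (e a : R) : CyclicQuotient e a :=
  Submodule.Quotient.mk ⟨e, Submodule.mem_span_singleton_self e⟩

theorem mk_eq_smul_generator (he : IsIdempotentElem e) (r : Submodule.span R {e}) :
    (Submodule.Quotient.mk r : CyclicQuotient e a) = (r : R) • generator e a := by
  obtain ⟨s, hs⟩ := Submodule.mem_span_singleton.1 r.2
  rw [generator, ← Submodule.Quotient.mk_smul]
  congr 1
  ext
  rw [Submodule.coe_smul, smul_eq_mul, ← hs, smul_eq_mul, mul_assoc, he.eq]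

theorem self_smul_generator (he : IsIdempotentElem e) : e • generator e a = generator e a :=
  (mk_eq_smul_generator he ⟨e, Submodule.mem_span_singleton_self e⟩).symm

theorem smul_generator_eq_zero (he : IsIdempotentElem e) (hae : a * e = a) :
    a • generator e a = 0 := by
  rw [← mk_eq_smul_generator he ⟨a, Submodule.mem_span_singleton.2 ⟨a, hae⟩⟩,
    Submodule.Quotient.mk_eq_zero]
  exact Submodule.mem_span_singleton_self a

theorem linearMap_ext {M : Type*} [AddCommGroup M] [Module R M] (he : IsIdempotentElem e)
    {g h : CyclicQuotient e a →ₗ[R] M} (hgh : g (generator e a) = h (generator e a)) : g = h := by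
  refine LinearMap.ext fun z ↦ ?_
  obtain ⟨r, rfl⟩ := Submodule.Quotient.mk_surjective _ z
  rw [mk_eq_smul_generator he, map_smul, map_smul, hgh]

theorem exists_linearMap_generator_eq {M : Type*} [AddCommGroup M] [Module R M] (e : R) {m : M}
    (ham : a • m = 0) : ∃ h : CyclicQuotient e a →ₗ[R] M, h (generator e a) = e • m := by
  refine ⟨Submodule.liftQ _
    (LinearMap.toSpanSingleton R M m ∘ₗ (Submodule.span R {e}).subtype) ?_, rfl⟩
  rintro ⟨r, hr⟩ hra
  obtain ⟨s, rfl⟩ := Submodule.mem_span_singleton.1 (show r ∈ Submodule.span R {a} from hra)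
  change (s * a) • m = 0
  rw [mul_smul, ham, smul_zero]

theorem isSplitEpimorphism_of_smul_eq_zero {M : Type*} [AddCommGroup M] [Module R M]
    (he : IsIdempotentElem e) {p : M →ₗ[R] CyclicQuotient e a} {m : M}
    (hpm : p m = generator e a) (ham : a • m = 0) : IsSplitEpimorphism p := by
  obtain ⟨s, hs⟩ := exists_linearMap_generator_eq e ham
  refine ⟨s, linearMap_ext he ?_⟩
  rw [LinearMap.comp_apply, hs, map_smul, hpm, self_smul_generator he, LinearMap.id_apply]

end CyclicQuotient

section LeftTerm

variable {R : Type u} [Ring R] {e a : R} {A B : Type u} [AddCommGroup A] [Module R A]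
  [AddCommGroup B] [Module R B] {i : A →ₗ[R] B}

-- The extension corresponds to the class of `x` in `Ext¹(Re / Ra, A)`, a subquotient of `A / aA`.
theorem exists_map_eq_smul_and_forall_smul_ne {p : B →ₗ[R] CyclicQuotient e a}
    (he : IsIdempotentElem e) (hae : a * e = a) (hi : Function.Injective i)
    (hip : Function.Exact i p) (hp : Function.Surjective p) (hsplit : ¬ IsSplitMonomorphism i) :
    ∃ x b, i x = a • b ∧ ∀ y, a • y ≠ x := by
  obtain ⟨b, hb⟩ := hp (CyclicQuotient.generator e a)
  obtain ⟨x, hx⟩ := (hip (a • b)).1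
    (by rw [map_smul, hb, CyclicQuotient.smul_generator_eq_zero he hae])
  refine ⟨x, b, hx, fun y hy ↦ hsplit (((hip.split_tfae hi hp).out 0 1).1 ?_)⟩
  refine CyclicQuotient.isSplitEpimorphism_of_smul_eq_zero he (m := b - i y) ?_ ?_
  · rw [map_sub, hb, hip.apply_apply_eq_zero, sub_zero]
  · rw [smul_sub, ← hx, ← map_smul, hy, sub_self]

theorem IsLeftAlmostSplit.exists_sub_smul_mem [Module.Finite R A] (hi : IsLeftAlmostSplit i)
    {x : A} {b : B} (hx : i x = a • b) {S : Submodule R A} (hS : S ≠ ⊥) :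
    ∃ y, x - a • y ∈ S := by
  have mkQ_not_split : ¬ IsSplitMonomorphism S.mkQ := by
    rintro ⟨r, hr⟩
    have hker : LinearMap.ker S.mkQ = ⊥ := LinearMap.ker_eq_bot_of_inverse hr
    exact hS (S.ker_mkQ.symm.trans hker)
  obtain ⟨h, hh⟩ := hi.2 (A ⧸ S) S.mkQ mkQ_not_split
  obtain ⟨y, hy⟩ := S.mkQ_surjective (h b)
  refine ⟨y, (Submodule.Quotient.eq S).1 ?_⟩
  change S.mkQ x = S.mkQ (a • y)
  rw [map_smul, hy, ← map_smul, ← hx, ← hh, LinearMap.comp_apply]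

end LeftTerm

theorem IsLeftAlmostSplit.isUniformOrder_submodule {K : Type v} [Field K] {Λ : Type u} [Ring Λ]
    [Algebra K Λ] [Module.Finite K Λ] {e f a : Λ} (he : IsIdempotentElem e)
    (hf : IsPrimitiveIdempotent f) (hfa : f * a = a) (hae : a * e = a)
    {A B : Type u} [AddCommGroup A] [Module Λ A] [Module.Finite Λ A] [AddCommGroup B]
    [Module Λ B] {i : A →ₗ[Λ] B} {p : B →ₗ[Λ] CyclicQuotient e a} (hinj : Function.Injective i)
    (hip : Function.Exact i p) (hp : Function.Surjective p) (hi : IsLeftAlmostSplit i) :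
    IsUniformOrder (Submodule Λ A) := by
  obtain ⟨x, b, hx, hxa⟩ := exists_map_eq_smul_and_forall_smul_ne he hae hinj hip hp hi.1
  have hfx : f • x = x := hinj (by rw [map_smul, hx, smul_smul, hfa])
  let _ : Module K A := Module.compHom A (algebraMap K Λ)
  have : IsScalarTower K Λ A := .of_algebraMap_smul fun _ _ ↦ rfl
  obtain ⟨φ, hφx, hφa⟩ := Submodule.exists_le_ker_of_notMem
    (p := LinearMap.range (Algebra.lsmul K K A a)) (v := x) fun ⟨y, hy⟩ ↦ hxa y hy
  have φ_smul (y : A) : φ (a • y) = 0 := hφa ⟨y, rfl⟩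
  refine hf.isUniformOrder_submodule (ψ := φ ∘ₗ Algebra.lsmul K K A f) (fun y ↦ ?_) fun S hS ↦ ?_
  · change φ (f • f • y) = φ (f • y)
    rw [smul_smul, hf.1.eq]
  · obtain ⟨y, hy⟩ := hi.exists_sub_smul_mem hx hS
    refine ⟨_, hy, ?_⟩
    change φ (f • (x - a • y)) ≠ 0
    rwa [smul_sub, smul_smul, hfa, hfx, map_sub, φ_smul, sub_zero]

theorem mainTheorem11_general {K : Type v} [Field K] {Λ : Type u} [Ring Λ] [Algebra K Λ]
    [Module.Finite K Λ] {e f a : Λ} (he : IsIdempotentElem e) (hf : IsPrimitiveIdempotent f)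
    (hfa : f * a = a) (hae : a * e = a) (hU : IsUniformOrder (Submodule Λ (CyclicQuotient e a)))
    {A B : Type u} [AddCommGroup A] [Module Λ A] [Module.Finite Λ A] [AddCommGroup B]
    [Module Λ B] {i : A →ₗ[Λ] B} {p : B →ₗ[Λ] CyclicQuotient e a} (hinj : Function.Injective i)
    (hip : Function.Exact i p) (hp : Function.Surjective p) (hi : IsLeftAlmostSplit i) :
    (∃ n : ℕ, n ≤ 2 ∧ HasIndecomposableDecomposition Λ B n) ∧
      ∀ n : ℕ, HasIndecomposableDecomposition Λ B n → n ≤ 2 := by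
  have hA : IsUniformOrder (Submodule Λ A) :=
    hi.isUniformOrder_submodule (K := K) he hf hfa hae hinj hip hp
  have hB : UniformDimLETwo (Submodule Λ B) := .of_exact hinj hip hp hA hU
  exact ⟨hB.exists_hasIndecomposableDecomposition,
    fun _ ↦ hB.le_two_of_hasIndecomposableDecomposition⟩

theorem mainTheorem11 {K : Type v} [Field K] {Λ : Type u} [Ring Λ] [Algebra K Λ]
    [Module.Finite K Λ] (e f a : Λ) (he : IsPrimitiveIdempotent e)
    (hf : IsPrimitiveIdempotent f) (ha : a ∈ radicalCorner f e) (ha0 : a ≠ 0)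
    (hU : IsUniserial Λ (CyclicQuotient e a))
    {A B : Type u} [AddCommGroup A] [Module Λ A] [AddCommGroup B] [Module Λ B]
    (i : A →ₗ[Λ] B) (p : B →ₗ[Λ] CyclicQuotient e a) (hip : IsAlmostSplitSequence i p) :
    (∃ n : ℕ, n ≤ 2 ∧ HasIndecomposableDecomposition Λ B n) ∧
      ∀ n : ℕ, HasIndecomposableDecomposition Λ B n → n ≤ 2 := by
  obtain ⟨j, -, rfl⟩ := ha
  have := hip.finite_left
  exact mainTheorem11_general (K := K) he.1 hf (by simp only [← mul_assoc, hf.1.eq])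
    (by simp only [mul_assoc, he.1.eq]) (.of_total hU.le_total) hip.injective hip.exact
    hip.surjective hip.leftAlmostSplit
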